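/- For a permutation $\pi=\pi_1\cdots\pi_n$ of $\{1,\dots,n\}$, let $G_\pi$ be the grid graph with vertex set $\{(i,j): 1\le i\le n,\ 1\le j\le \pi_i\}$, in which $(i,j)$ and $(i',j')$ are adjacent if and only if either $i=i'$ and $|j-j'|=1$, or $|i-i'|=1$ and $j=j'$. Let $\mathrm{Av}_n(213)$ be the set of permutations $\pi$ of $\{1,\dots,n\}$ that avoid the pattern $213$, i.e. for which there are no positions $i<j<k$ with $\pi_j<\pi_i<\pi_k$. For $r\in\{1,2,3,4\}$ put \[ Q_r(n)=\sum_{\pi\in\mathrm{Av}_n(213)}\#\{v\in V(G_\pi):\deg(v)=r\},\qquad V_n=\frac n2\binom{2n}{n}. \] Then $V_n=\sum_{\pi\in\mathrm{Av}_n(213)}|V(G_\pi)|$ is the total number of vertices for every $n\ge 0$, and, as $n\to\infty$, \begin{align*} \frac{Q_1(n)}{V_n}&=\frac1{2n}+O(n^{-2}), & \frac{Q_2(n)}{V_n}&=\frac{\sqrt\pi}{8}\,n^{-1/2}+O(n^{-1}),\\ \frac{Q_3(n)}{V_n}&=\frac{3\sqrt\pi}{4}\,n^{-1/2}+O(n^{-1}),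 & \frac{Q_4(n)}{V_n}&=1-\frac{7\sqrt\pi}{8}\,n^{-1/2}+O(n^{-1}), \end{align*} where $\sqrt\pi$ denotes the square root of the circle constant. In particular, the proportion $Q_4(n)/V_n$ of degree-$4$ vertices tends to $1$. -/

import Mathlib

open Asymptotics

/-- The permutation `π` of `{0, …, n-1}` (in one-line notation `π 0, π 1, …`) avoids the
pattern `213`: there are no positions `i < j < k` with `π j < π i < π k`. -/
def Avoids213 {n : ℕ} (π : Equiv.Perm (Fin n)) : Prop :=
  ¬ ∃ i j k : Fin n, i < j ∧ j < k ∧ π j < π i ∧ π i < π k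

instance Avoids213.instDecidablePred {n : ℕ} : DecidablePred (Avoids213 (n := n)) :=
  fun π => by unfold Avoids213; infer_instance

/-- The set of `213`-avoiding permutations of size `n`. -/
def av213 (n : ℕ) : Finset (Equiv.Perm (Fin n)) :=
  Finset.univ.filter Avoids213

/-- Vertices of the grid graph of `π`: column `i` has `π_i` cells, one at each of the levels
`1, …, π_i`. Positions, values and levels are all shifted down by one, so the pair `(i, j)` of
elements of `Fin n` stands for the usual `(i + 1, j + 1)`, and `j + 1 ≤ π_{i+1}` reads
`j ≤ π i`. -/
abbrev GridVertex {n : ℕ} (π : Equiv.Perm (Fin n)) : Type :=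
  {p : Fin n × Fin n // p.2 ≤ π p.1}

/-- `a` and `b` differ by exactly one. -/
def Consecutive {n : ℕ} (a b : Fin n) : Prop :=
  (a : ℕ) + 1 = (b : ℕ) ∨ (b : ℕ) + 1 = (a : ℕ)

instance Consecutive.instDecidable {n : ℕ} (a b : Fin n) : Decidable (Consecutive a b) := by
  unfold Consecutive; infer_instance

/-- The grid graph of `π`: vertical edges join consecutive levels of one column, horizontal
edges join equal levels of consecutive columns. -/
def gridGraph {n : ℕ} (π : Equiv.Perm (Fin n)) : SimpleGraph (GridVertex π) where
  Adj u v :=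
    (u.1.1 = v.1.1 ∧ Consecutive u.1.2 v.1.2) ∨ (Consecutive u.1.1 v.1.1 ∧ u.1.2 = v.1.2)
  symm := ⟨by
    rintro u v (⟨h₁, h₂⟩ | ⟨h₁, h₂⟩)
    · exact Or.inl ⟨h₁.symm, h₂.symm⟩
    · exact Or.inr ⟨h₁.symm, h₂.symm⟩⟩
  loopless := ⟨by
    rintro u (⟨-, h⟩ | ⟨h, -⟩) <;> · unfold Consecutive at h; omega⟩

instance gridGraph.instDecidableRel {n : ℕ} (π : Equiv.Perm (Fin n)) :
    DecidableRel (gridGraph π).Adj :=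
  fun u v => by unfold gridGraph; infer_instance

/-- `degreeTotal r n` is the number `Q_r(n)` of vertices of degree `r`, summed over the grid
graphs of all `213`-avoiding permutations of size `n`. -/
def degreeTotal (r n : ℕ) : ℕ :=
  ∑ π ∈ av213 n, (Finset.univ.filter fun v : GridVertex π => (gridGraph π).degree v = r).card

/-- The number of vertices, summed over the grid graphs of all `213`-avoiding permutations of
size `n`. -/
def vertexTotal (n : ℕ) : ℕ :=
  ∑ π ∈ av213 n, Fintype.card (GridVertex π)

/-- `V_n = (n / 2) * B_n` with `B_n = binom(2n, n)`. -/
noncomputable def gridV (n : ℕ) : ℝ :=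
  (n : ℝ) / 2 * (Nat.choose (2 * n) n : ℝ)

/-!
Reading a `213`-avoiding permutation at its smallest value, every value to the left exceeds every
value to the right, so these permutations are coded by binary trees.

With empty columns as padding, the degree of a cell depends only on the heights `a`, `b`, `c` of
its column and of the two neighbouring ones. Apart from the bottom and the top cell, a cell has two
vertical neighbours, so up to a bounded error per column the numbers of cells of degree `2`, `3`
and `4` are `P`, `E - 2 * P` and `b - E + P`, where `P` counts the cells rising above both
neighbouring columns and `E` the sides of cells not shared with them. The cells of degree `1` are
the tops of the peaks, except possibly in the first and the last column.

The sums of the peak indicator, of `E` and of `P` over the columns are additive over binary trees,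
each node contributing a toll which depends only on the sizes of its two subtrees. Summing a toll
over all nodes of all trees instead of over the roots only multiplies the generating function by
`B`, the series of the central binomial coefficients. This yields `X * B` for the peaks,
`2 * X * B ^ 2` for `E` and `X * (2 * X * B ^ 2 + B + 1) / 2` for `P`. As `B ^ 2` has coefficients
`4 ^ n`, the totals of `E` and `P` for `n ≥ 2` are `4 ^ n / 2` and
`4 ^ n / 16 + centralBinom (n - 1) / 2`, and the Wallis product gives
`4 ^ n / centralBinom n = √(π n) + O(1)`.
-/

open BinaryTree Finset
open PowerSeries (coeff X)

/-- The `213`-avoiding word of the letters `s, s + 1, …` whose smallest letter separates the word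
of the left subtree from the word of the right subtree. Avoidance forces every letter on the left
to exceed every letter on the right, hence the two offsets. -/
def treeWord (s : ℕ) : BinaryTree Unit → List ℕ
  | .nil => []
  | .node _ L R => treeWord (s + 1 + R.numNodes) L ++ s :: treeWord (s + 1) R

/-- The word has no subsequence `a, b, c` with `b < a < c`. -/
def WordAvoids213 (l : List ℕ) : Prop :=
  l.Triplewise fun a b c => ¬(b < a ∧ a < c)

theorem treeWord_perm_range' (t : BinaryTree Unit) (s : ℕ) :
    (treeWord s t).Perm (List.range' s t.numNodes) := by
  induction t generalizing s with
  | nil => exact .refl _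
  | node _ L R ihL ihR =>
    calc treeWord (s + 1 + R.numNodes) L ++ s :: treeWord (s + 1) R
      _ |>.Perm (s :: (treeWord (s + 1) R ++ treeWord (s + 1 + R.numNodes) L)) :=
        List.perm_middle.trans (List.perm_append_comm.cons s)
      _ |>.Perm (s :: (List.range' (s + 1) R.numNodes ++
          List.range' (s + 1 + R.numNodes) L.numNodes)) := ((ihR _).append (ihL _)).cons s
      _ = List.range' s (L.numNodes + R.numNodes + 1) := by
        rw [List.range'_append_1, add_comm R.numNodes, ← List.range'_succ]

theorem length_treeWord (s : ℕ) (t : BinaryTree Unit) : (treeWord s t).length = t.numNodes := by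
  simpa using (treeWord_perm_range' t s).length_eq

theorem le_of_mem_treeWord {s x : ℕ} {t : BinaryTree Unit} (hx : x ∈ treeWord s t) : s ≤ x :=
  (List.mem_range'_1.1 ((treeWord_perm_range' t s).mem_iff.1 hx)).1

theorem treeWord_injective (s : ℕ) : Function.Injective (treeWord s) := by
  intro t t' h
  induction t generalizing s t' with
  | nil => cases t' <;> simp_all [treeWord]
  | node _ L R ihL ihR =>
    cases t' with
    | nil => simp [treeWord] at h
    | node _ L' R' =>
      obtain ⟨hL, -, hR⟩ := (List.append_cons_inj_of_notMem
        (fun hs => by have := le_of_mem_treeWord hs; omega)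
        (fun hs => by have := le_of_mem_treeWord hs; omega)).1 h
      obtain rfl := ihR _ hR
      obtain rfl := ihL _ hL
      rfl

theorem wordAvoids213_append_cons_iff {s : ℕ} {l₁ l₂ : List ℕ} (h₁ : ∀ x ∈ l₁, s < x)
    (h₂ : ∀ x ∈ l₂, s < x) :
    WordAvoids213 (l₁ ++ s :: l₂) ↔
      WordAvoids213 l₁ ∧ WordAvoids213 l₂ ∧ ∀ x ∈ l₁, ∀ y ∈ l₂, y ≤ x := by
  simp only [WordAvoids213, List.triplewise_append, List.triplewise_cons,
    List.pairwise_iff_forall_sublist]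
  grind

theorem wordAvoids213_treeWord (t : BinaryTree Unit) (s : ℕ) : WordAvoids213 (treeWord s t) := by
  induction t generalizing s with
  | nil => exact .nil
  | node _ L R ihL ihR =>
    refine (wordAvoids213_append_cons_iff ?_ ?_).2 ⟨ihL _, ihR _, ?_⟩
    · intro x hx
      have := le_of_mem_treeWord hx
      omega
    · intro x hx
      exact le_of_mem_treeWord hx
    · intro x hx y hy
      have hx' := le_of_mem_treeWord hx
      have hy' := List.mem_range'_1.1 ((treeWord_perm_range' R _).mem_iff.1 hy)
      omega

theorem perm_range'_of_append_perm_range' {s n : ℕ} {l₁ l₂ : List ℕ}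
    (hperm : (l₁ ++ l₂).Perm (List.range' s n)) (hle : ∀ x ∈ l₁, ∀ y ∈ l₂, x ≤ y) :
    l₁.Perm (List.range' s l₁.length) ∧
      l₂.Perm (List.range' (s + l₁.length) l₂.length) := by
  have hsorted : (l₁.mergeSort ++ l₂.mergeSort).Pairwise (· ≤ ·) := by
    refine List.pairwise_append.2 ⟨?_, ?_, fun x hx y hy => ?_⟩
    · simpa using List.pairwise_mergeSort' (· ≤ ·) l₁
    · simpa using List.pairwise_mergeSort' (· ≤ ·) l₂
    · exact hle x (List.mem_mergeSort.1 hx) y (List.mem_mergeSort.1 hy)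
  have heq : l₁.mergeSort ++ l₂.mergeSort = List.range' s n :=
    (((List.mergeSort_perm l₁ _).append (List.mergeSort_perm l₂ _)).trans hperm).eq_of_pairwise'
      hsorted List.pairwise_le_range'
  have hn : n = l₁.mergeSort.length + l₂.mergeSort.length := by
    rw [← List.length_append, heq, List.length_range']
  rw [hn, ← List.range'_append_1] at heq
  obtain ⟨h₁, h₂⟩ := List.append_inj heq (by simp)
  simp only [List.length_mergeSort] at h₁ h₂
  exact ⟨h₁ ▸ (List.mergeSort_perm l₁ _).symm, h₂ ▸ (List.mergeSort_perm l₂ _).symm⟩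

theorem exists_treeWord_eq {s n : ℕ} {l : List ℕ} (hperm : l.Perm (List.range' s n))
    (havoid : WordAvoids213 l) : ∃ t : BinaryTree Unit, treeWord s t = l := by
  induction n using Nat.strong_induction_on generalizing s l with
  | _ n ih =>
    rcases n with _ | n
    · exact ⟨.nil, (List.perm_nil.1 hperm).symm⟩
    obtain ⟨l₁, l₂, rfl⟩ := List.append_of_mem (hperm.mem_iff.2 (by simp : s ∈ _))
    have hrest : (l₂ ++ l₁).Perm (List.range' (s + 1) n) := by
      refine List.Perm.cons_inv (a := s) ?_
      rw [← List.range'_succ]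
      exact ((List.perm_append_comm.cons s).trans List.perm_middle.symm).trans hperm
    have hlt : ∀ x ∈ l₂ ++ l₁, s < x := fun x hx =>
      (List.mem_range'_1.1 (hrest.mem_iff.1 hx)).1
    obtain ⟨h₁, h₂, hle⟩ := (wordAvoids213_append_cons_iff
      (fun x hx => hlt x (List.mem_append_right _ hx))
      (fun x hx => hlt x (List.mem_append_left _ hx))).1 havoid
    obtain ⟨hperm₂, hperm₁⟩ :=
      perm_range'_of_append_perm_range' hrest fun x hx y hy => hle y hy x hx
    have hlen : l₂.length + l₁.length = n := by simpa using hrest.length_eq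
    obtain ⟨R, rfl⟩ := ih _ (by omega) hperm₂ h₂
    rw [length_treeWord] at hperm₁
    obtain ⟨L, rfl⟩ := ih _ (by omega) hperm₁ h₁
    exact ⟨.node () L R, rfl⟩

/-- The one-line notation of `π`, with values counted from `1`: the list of the heights of the
columns of the grid graph. -/
def columnHeights {n : ℕ} (π : Equiv.Perm (Fin n)) : List ℕ :=
  List.ofFn fun i => (π i : ℕ) + 1

@[simp]
theorem length_columnHeights {n : ℕ} (π : Equiv.Perm (Fin n)) : (columnHeights π).length = n :=
  List.length_ofFn

@[simp]
theorem getElem_columnHeights {n : ℕ} (π : Equiv.Perm (Fin n)) (i : ℕ)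
    (hi : i < (columnHeights π).length) :
    (columnHeights π)[i] = (π ⟨i, by simpa using hi⟩ : ℕ) + 1 :=
  List.getElem_ofFn _

theorem columnHeights_perm_range' {n : ℕ} (π : Equiv.Perm (Fin n)) :
    (columnHeights π).Perm (List.range' 1 n) := by
  have h : List.ofFn (fun i : Fin n => (i : ℕ) + 1) = List.range' 1 n :=
    List.ext_getElem (by simp) (by simp [add_comm])
  exact h ▸ π.ofFn_comp_perm fun i : Fin n => (i : ℕ) + 1

theorem columnHeights_injective (n : ℕ) :
    Function.Injective (columnHeights : Equiv.Perm (Fin n) → List ℕ) := by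
  intro π σ h
  ext i
  simpa using congrFun (List.ofFn_injective h) i

theorem wordAvoids213_columnHeights_iff {n : ℕ} {π : Equiv.Perm (Fin n)} :
    WordAvoids213 (columnHeights π) ↔ Avoids213 π := by
  simp only [WordAvoids213, List.triplewise_iff_getElem, getElem_columnHeights, Avoids213,
    length_columnHeights, not_exists, not_and, add_lt_add_iff_right, Fin.val_fin_lt]
  exact ⟨fun h i j k hij hjk => h i j k hij hjk k.2,
    fun h i j k hij hjk hk => h ⟨i, by omega⟩ ⟨j, by omega⟩ ⟨k, hk⟩ hij hjk⟩

theorem exists_columnHeights_eq {n : ℕ} {l : List ℕ} (hperm : l.Perm (List.range' 1 n)) :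
    ∃ π : Equiv.Perm (Fin n), columnHeights π = l := by
  have hlen : l.length = n := by simpa using hperm.length_eq
  have hnodup : l.Nodup := hperm.nodup_iff.2 List.nodup_range'
  have hmem (i : Fin n) : 1 ≤ l[i] ∧ l[i] < 1 + n :=
    List.mem_range'_1.1 (hperm.mem_iff.1 (List.getElem_mem _))
  have hinj : Function.Injective fun i : Fin n =>
      (⟨l[i] - 1, by have := hmem i; omega⟩ : Fin n) := by
    intro i j hij
    have h : l[i] - 1 = l[j] - 1 := congrArg Fin.val hij
    have hi := hmem i
    have hj := hmem j
    exact Fin.ext ((hnodup.getElem_inj_iff).1 (by simp only [Fin.getElem_fin] at *; omega))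
  refine ⟨.ofBijective _ (Finite.injective_iff_bijective.1 hinj),
    List.ext_getElem (by simp [hlen]) fun i hi _ => ?_⟩
  have := hmem ⟨i, by simpa using hi⟩
  simp only [Fin.getElem_fin] at this
  simp only [getElem_columnHeights, Equiv.ofBijective_apply, Fin.getElem_fin]
  omega

theorem image_columnHeights_av213 (n : ℕ) :
    (av213 n).image columnHeights = (treesOfNumNodesEq n).image (treeWord 1) := by
  ext l
  simp only [av213, mem_image, mem_filter, mem_univ, true_and, mem_treesOfNumNodesEq]
  constructor
  · rintro ⟨π, hπ, rfl⟩
    obtain ⟨t, ht⟩ := exists_treeWord_eq (columnHeights_perm_range' π)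
      (wordAvoids213_columnHeights_iff.2 hπ)
    exact ⟨t, by rw [← length_treeWord 1, ht, length_columnHeights], ht⟩
  · rintro ⟨t, rfl, rfl⟩
    obtain ⟨π, hπ⟩ := exists_columnHeights_eq (treeWord_perm_range' t 1)
    exact ⟨π, wordAvoids213_columnHeights_iff.1 (hπ ▸ wordAvoids213_treeWord t 1), hπ⟩

theorem sum_av213_eq_sum_trees {M : Type*} [AddCommMonoid M] (F : List ℕ → M) (n : ℕ) :
    ∑ π ∈ av213 n, F (columnHeights π) = ∑ t ∈ treesOfNumNodesEq n, F (treeWord 1 t) := by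
  rw [← sum_image (f := F) (columnHeights_injective n).injOn, image_columnHeights_av213,
    sum_image (treeWord_injective 1).injOn]

theorem card_av213 (n : ℕ) : #(av213 n) = catalan n := by
  rw [← treesOfNumNodesEq_card_eq_catalan, ← card_image_of_injective _ (columnHeights_injective n),
    image_columnHeights_av213, card_image_of_injective _ (treeWord_injective 1)]

section Windows

variable {α M : Type*}

/-- The sum of `f` over all triples of consecutive letters of the word `a :: l ++ [z]`: each letter
of `l` contributes once, as the middle letter, and `a` and `z` serve as the outer neighbours of the
two ends. -/
def windowSum [AddCommMonoid M] (f : α → α → α → M) : α → List α → α → M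
  | _, [], _ => 0
  | a, b :: l, z => f a b (l.headD z) + windowSum f b l z

theorem windowSum_append_cons [AddCommMonoid M] (f : α → α → α → M) (a b z : α) (l₁ l₂ : List α) :
    windowSum f a (l₁ ++ b :: l₂) z =
      windowSum f a l₁ b + f (l₁.getLastD a) b (l₂.headD z) + windowSum f b l₂ z := by
  induction l₁ generalizing a with
  | nil => simp [windowSum]
  | cons c l ih =>
    have hhead : (l ++ b :: l₂).headD z = l.headD b := by cases l <;> rfl
    simp only [List.cons_append, windowSum, ih, hhead, List.getLastD_cons, add_assoc]

theorem windowSum_eq_sum_range [AddCommMonoid M] (f : α → α → α → M) (a z : α) (l : List α) :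
    windowSum f a l z =
      ∑ i ∈ range l.length, f ((a :: l).getD i z) (l.getD i z) (l.getD (i + 1) z) := by
  induction l generalizing a with
  | nil => rfl
  | cons b l ih =>
    have hhead : l.headD z = l.getD 0 z := by cases l <;> rfl
    rw [windowSum, ih, List.length_cons, sum_range_succ', add_comm, hhead]
    rfl

theorem windowSum_const [AddCommMonoid M] (K : M) (a z : α) (l : List α) :
    windowSum (fun _ _ _ => K) a l z = l.length • K := by
  rw [windowSum_eq_sum_range, sum_const, card_range]

theorem abs_windowSum_sub_le {f g h : α → α → α → ℤ}
    (hfg : ∀ a b c, |f a b c - g a b c| ≤ h a b c) (a z : α) (l : List α) :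
    |windowSum f a l z - windowSum g a l z| ≤ windowSum h a l z := by
  simp only [windowSum_eq_sum_range, ← sum_sub_distrib]
  exact (abs_sum_le_sum_abs _ _).trans (sum_le_sum fun i _ => hfg _ _ _)

end Windows

section GridGraph

variable {n : ℕ} (π : Equiv.Perm (Fin n))

/-- The height of the column in position `x = 1, …, n` of the grid graph of `π`; positions outside
this range carry an empty column. -/
def paddedHeight (x : ℕ) : ℕ :=
  (0 :: columnHeights π).getD x 0

/-- The degree of the cell at level `j`, counted from `0`, of a column of height `b` whose
neighbouring columns have heights `a` and `c`. -/
def cellDegree (a b c j : ℕ) : ℕ :=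
  (if 0 < j then 1 else 0) + (if j + 1 < b then 1 else 0) +
    ((if j < a then 1 else 0) + if j < c then 1 else 0)

/-- The number of cells of degree `r` in a column of height `b` whose neighbouring columns have
heights `a` and `c`. -/
def columnCount (r a b c : ℕ) : ℕ :=
  #{j ∈ range b | cellDegree a b c j = r}

theorem paddedHeight_succ_val (i : Fin n) : paddedHeight π (i + 1) = π i + 1 := by
  simp [paddedHeight]

theorem paddedHeight_eq_zero {x : ℕ} (hx : n < x) : paddedHeight π x = 0 :=
  List.getD_eq_default _ _ (by simpa using hx)

theorem windowSum_columnHeights {M : Type*} [AddCommMonoid M] (f : ℕ → ℕ → ℕ → M) :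
    windowSum f 0 (columnHeights π) 0 =
      ∑ i ∈ range n, f (paddedHeight π i) (paddedHeight π (i + 1)) (paddedHeight π (i + 2)) := by
  rw [windowSum_eq_sum_range, length_columnHeights]
  rfl

theorem sum_gridVertex {M : Type*} [AddCommMonoid M] (F : ℕ → ℕ → M) :
    ∑ v : GridVertex π, F v.1.1 v.1.2 =
      ∑ i ∈ range n, ∑ j ∈ range (paddedHeight π (i + 1)), F i j := by
  let e : GridVertex π ≃ Σ i : Fin n, Fin (π i + 1) :=
    { toFun := fun v => ⟨v.1.1, v.1.2, Nat.lt_succ_of_le v.2⟩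
      invFun := fun c => ⟨(c.1, c.2.castLE (π c.1).2), Nat.le_of_lt_succ c.2.2⟩
      left_inv := fun _ => rfl
      right_inv := fun _ => rfl }
  calc ∑ v : GridVertex π, F v.1.1 v.1.2
      _ = ∑ c : Σ i : Fin n, Fin (π i + 1), F c.1 c.2 := Fintype.sum_equiv e _ _ fun _ => rfl
      _ = ∑ i : Fin n, ∑ j ∈ range (paddedHeight π (i + 1)), F i j := by
        simp only [Fintype.sum_sigma, paddedHeight_succ_val, Fin.sum_univ_eq_sum_range (F _)]
      _ = ∑ i ∈ range n, ∑ j ∈ range (paddedHeight π (i + 1)), F i j :=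
        Fin.sum_univ_eq_sum_range (fun i => ∑ j ∈ range (paddedHeight π (i + 1)), F i j) n

theorem card_gridVertex_at (x y : ℕ) :
    #{u : GridVertex π | (u.1.1 : ℕ) + 1 = x ∧ (u.1.2 : ℕ) = y} =
      if y < paddedHeight π x then 1 else 0 := by
  rw [card_filter, sum_gridVertex π fun i j => if i + 1 = x ∧ j = y then 1 else 0]
  rcases x with _ | x
  · simp [paddedHeight]
  · rcases lt_or_ge x n with hx | hx
    · simp [ite_and, sum_ite_eq', hx, Finset.sum_ite_irrel]
    · simp [ite_and, paddedHeight_eq_zero π (Nat.lt_succ_of_le hx)]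

theorem card_gridVertex_below (v : GridVertex π) :
    #{u : GridVertex π | (u.1.1 : ℕ) + 1 = v.1.1 + 1 ∧ (u.1.2 : ℕ) + 1 = v.1.2} =
      if 0 < (v.1.2 : ℕ) then 1 else 0 := by
  have hv : (v.1.2 : ℕ) < paddedHeight π (v.1.1 + 1) := by
    rw [paddedHeight_succ_val]
    exact Nat.lt_succ_of_le v.2
  rcases h : (v.1.2 : ℕ) with _ | j
  · simp
  · have hcard := card_gridVertex_at π (v.1.1 + 1) j
    rw [if_pos (by omega)] at hcard
    simpa only [add_left_inj, j.succ_pos, if_true] using hcard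

theorem degree_gridGraph (v : GridVertex π) :
    (gridGraph π).degree v = cellDegree (paddedHeight π v.1.1) (paddedHeight π (v.1.1 + 1))
      (paddedHeight π (v.1.1 + 2)) v.1.2 := by
  rw [← SimpleGraph.card_neighborFinset_eq_degree, SimpleGraph.neighborFinset_eq_filter, cellDegree,
    ← card_gridVertex_below, ← card_gridVertex_at, ← card_gridVertex_at, ← card_gridVertex_at]
  simp only [card_filter, ← sum_add_distrib]
  refine sum_congr rfl fun u _ => ?_
  simp only [gridGraph, Consecutive, Fin.ext_iff]
  split_ifs <;> omega

theorem card_degree_eq_windowSum (r : ℕ) :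
    #{v : GridVertex π | (gridGraph π).degree v = r} =
      windowSum (columnCount r) 0 (columnHeights π) 0 := by
  simp only [windowSum_columnHeights, columnCount, card_filter, degree_gridGraph]
  rw [sum_gridVertex π fun i j => if cellDegree (paddedHeight π i) (paddedHeight π (i + 1))
    (paddedHeight π (i + 2)) j = r then 1 else 0]

end GridGraph

section ColumnStatistics

/-- The indicator of `b` being a peak between its neighbours `a` and `c`. -/
def peak (a b c : ℕ) : ℤ :=
  if a < b ∧ c < b then 1 else 0

/-- The number of cells of a column of height `b` which are above both neighbouring columns, of
heights `a` and `c`. -/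
def prominence (a b c : ℕ) : ℤ :=
  (b - max a c : ℕ)

/-- The number of sides of cells of a column of height `b` which are not shared with the
neighbouring columns, of heights `a` and `c`. -/
def exposure (a b c : ℕ) : ℤ :=
  (b - a : ℕ) + (b - c : ℕ)

/-- The number of cells of a column of height `b` with exactly `k` neighbours in the neighbouring
columns, of heights `a` and `c`. -/
def sideCount (k a b c : ℕ) : ℕ :=
  #{j ∈ range b | (if j < a then 1 else 0) + (if j < c then 1 else 0) = k}

theorem sideCount_zero (a b c : ℕ) : (sideCount 0 a b c : ℤ) = prominence a b c := by
  have h : {j ∈ range b | (if j < a then 1 else 0) + (if j < c then 1 else 0) = 0} =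
      Ico (max a c) b := by
    ext j
    simp only [mem_filter, mem_range, mem_Ico, max_le_iff]
    grind
  rw [sideCount, h, Nat.card_Ico, prominence]

theorem sideCount_two (a b c : ℕ) :
    (sideCount 2 a b c : ℤ) = b - (exposure a b c - prominence a b c) := by
  have h : {j ∈ range b | (if j < a then 1 else 0) + (if j < c then 1 else 0) = 2} =
      range (min b (min a c)) := by
    ext j
    simp only [mem_filter, mem_range, lt_min_iff]
    grind
  rw [sideCount, h, card_range, exposure, prominence]
  omega

theorem sum_sideCount (a b c : ℕ) :
    sideCount 0 a b c + sideCount 1 a b c + sideCount 2 a b c = b := by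
  simp only [sideCount, card_filter, ← sum_add_distrib]
  refine (sum_congr rfl fun j _ => ?_).trans
    ((card_eq_sum_ones (range b)).symm.trans (card_range b))
  by_cases ha : j < a <;> by_cases hc : j < c <;> simp [ha, hc]

theorem sideCount_one (a b c : ℕ) :
    (sideCount 1 a b c : ℤ) = exposure a b c - 2 * prominence a b c := by
  have := sum_sideCount a b c
  have := sideCount_zero a b c
  have := sideCount_two a b c
  omega

theorem card_le_card_add_two {s t : Finset ℕ} {x y : ℕ}
    (h : ∀ j ∈ s, j ≠ x → j ≠ y → j ∈ t) : #s ≤ #t + 2 := by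
  have hsub : s ⊆ t ∪ {x, y} := fun j hj => by
    simp only [mem_union, mem_insert, mem_singleton]
    grind
  exact (card_le_card hsub).trans ((card_union_le _ _).trans (by gcongr; exact card_le_two))

theorem cellDegree_of_interior (a c : ℕ) {b j : ℕ} (hj : 0 < j) (hjb : j + 1 < b) :
    cellDegree a b c j = (if j < a then 1 else 0) + (if j < c then 1 else 0) + 2 := by
  rw [cellDegree, if_pos hj, if_pos hjb, add_comm]

theorem abs_columnCount_sub_sideCount_le (k a b c : ℕ) :
    |(columnCount (k + 2) a b c : ℤ) - sideCount k a b c| ≤ 2 := by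
  have h₁ : columnCount (k + 2) a b c ≤ sideCount k a b c + 2 := by
    refine card_le_card_add_two (x := 0) (y := b - 1) fun j hj hbot htop => ?_
    simp only [mem_filter, mem_range] at hj ⊢
    rw [cellDegree_of_interior _ _ (by omega) (by omega)] at hj
    omega
  have h₂ : sideCount k a b c ≤ columnCount (k + 2) a b c + 2 := by
    refine card_le_card_add_two (x := 0) (y := b - 1) fun j hj hbot htop => ?_
    simp only [mem_filter, mem_range] at hj ⊢
    rw [cellDegree_of_interior _ _ (by omega) (by omega)]
    omega
  rw [abs_le]
  omega

theorem abs_columnCount_one_sub_peak_le (a b c : ℕ) :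
    |(columnCount 1 a b c : ℤ) - peak a b c| ≤
      (if a = 0 then 1 else 0) + (if c = 0 then 1 else 0) := by
  rcases b with _ | _ | b
  · simp only [columnCount, peak, range_zero, filter_empty, card_empty, not_lt_zero, and_self]
    positivity
  · simp only [columnCount, peak, cellDegree, card_filter, zero_add, sum_range_one]
    grind
  · have h : {j ∈ range (b + 2) | cellDegree a (b + 2) c j = 1} =
        ({0, b + 1} : Finset ℕ).filter fun j => cellDegree a (b + 2) c j = 1 := by
      ext j
      simp only [mem_filter, mem_range, mem_insert, mem_singleton]
      grind [cellDegree]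
    rw [columnCount, h, card_filter, sum_pair b.succ_ne_zero.symm]
    grind [cellDegree, peak]

theorem windowSum_zero_neighbours_le (a : ℕ) {l : List ℕ} (hl : ∀ x ∈ l, x ≠ 0) :
    windowSum (fun a _ c => (if a = 0 then 1 else 0) + (if c = 0 then 1 else 0) : ℕ → ℕ → ℕ → ℤ)
      a l 0 ≤ (if a = 0 then 1 else 0) + 1 := by
  induction l generalizing a with
  | nil => simp only [windowSum]; positivity
  | cons b l ih =>
    rcases l with _ | ⟨c, l⟩
    · simp [windowSum]
    · have := ih b (fun x hx => hl x (by simp [hx]))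
      have hb : b ≠ 0 := hl b (by simp)
      have hc : c ≠ 0 := hl c (by simp)
      rw [windowSum]
      simp only [List.headD_cons, hc, hb, if_false] at this ⊢
      linarith

end ColumnStatistics

section Tolls

/-- The additive functional on binary trees with toll function `e`: a node with subtrees of sizes
`p` and `q` contributes `e p q`. -/
def tollSum (e : ℕ → ℕ → ℤ) : BinaryTree Unit → ℤ
  | .nil => 0
  | .node _ L R => tollSum e L + tollSum e R + e L.numNodes R.numNodes

theorem treeWord_eq_nil_iff {s : ℕ} {t : BinaryTree Unit} : treeWord s t = [] ↔ t.numNodes = 0 := by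
  rw [← length_treeWord s, List.length_eq_zero_iff]

theorem le_headD_treeWord {s : ℕ} {t : BinaryTree Unit} (ht : t.numNodes ≠ 0) (z : ℕ) :
    s ≤ (treeWord s t).headD z := by
  have hne : treeWord s t ≠ [] := mt treeWord_eq_nil_iff.1 ht
  rw [List.headD_eq_head?_getD, List.head?_eq_some_head hne]
  exact le_of_mem_treeWord (List.head_mem hne)

theorem le_getLastD_treeWord {s : ℕ} {t : BinaryTree Unit} (ht : t.numNodes ≠ 0) (a : ℕ) :
    s ≤ (treeWord s t).getLastD a := by
  have hne : treeWord s t ≠ [] := mt treeWord_eq_nil_iff.1 ht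
  rw [List.getLastD_eq_getLast?, List.getLast?_eq_some_getLast hne]
  exact le_of_mem_treeWord (List.getLast_mem hne)

theorem exists_windowSum_treeWord_node {M : Type*} [AddCommMonoid M] (f : ℕ → ℕ → ℕ → M)
    (s a z : ℕ) (L R : BinaryTree Unit) :
    ∃ x y, windowSum f a (treeWord s (.node () L R)) z =
        windowSum f a (treeWord (s + 1 + R.numNodes) L) s + f x s y +
          windowSum f s (treeWord (s + 1) R) z ∧
      (if L.numNodes = 0 then x = a else s < x) ∧ (if R.numNodes = 0 then y = z else s < y) := by
  refine ⟨_, _, windowSum_append_cons f a s z _ _, ?_, ?_⟩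
  · split_ifs with h
    · rw [treeWord_eq_nil_iff.2 h, List.getLastD_nil]
    · exact lt_of_lt_of_le (by omega) (le_getLastD_treeWord h a)
  · split_ifs with h
    · rw [treeWord_eq_nil_iff.2 h, List.headD_nil]
    · exact le_headD_treeWord h z

theorem windowSum_peak_treeWord (t : BinaryTree Unit) {s a z : ℕ} (ha : a < s) (hz : z < s) :
    windowSum peak a (treeWord s t) z =
      tollSum (fun p q => (if p = 0 then 1 else 0) * (if q = 0 then 1 else 0)) t := by
  induction t generalizing s a z with
  | nil => rfl
  | node _ L R ihL ihR =>
    obtain ⟨x, y, h, hx, hy⟩ := exists_windowSum_treeWord_node peak s a z L R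
    have hroot : peak x s y =
        (if L.numNodes = 0 then 1 else 0) * (if R.numNodes = 0 then 1 else 0) := by
      rw [peak]
      split_ifs at hx hy ⊢ <;> omega
    rw [h, ihL (by omega) (by omega), ihR (by omega) (by omega), hroot, tollSum]
    ring

-- The tolls are written as sums of products `φ p * ψ q` so that their series factor.
theorem windowSum_exposure_treeWord (t : BinaryTree Unit) {s a z : ℕ} (ha : a < s) (hz : z < s) :
    windowSum exposure a (treeWord s t) z =
      tollSum (fun p q => 2 * 1 + (if p = 0 then 0 else 2) * q) t +
        (if t.numNodes = 0 then 0 else (s - 1 - a) + (s - 1 - z) : ℤ) := by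
  induction t generalizing s a z with
  | nil => rfl
  | node _ L R ihL ihR =>
    obtain ⟨x, y, h, hx, hy⟩ := exists_windowSum_treeWord_node exposure s a z L R
    have hroot : exposure x s y = (if L.numNodes = 0 then (s : ℤ) - a else 0) +
        (if R.numNodes = 0 then (s : ℤ) - z else 0) := by
      rw [exposure]
      split_ifs at hx hy ⊢ <;> omega
    rw [h, ihL (by omega) (by omega), ihR (by omega) (by omega), hroot, tollSum]
    simp only [numNodes, Nat.add_one_ne_zero, if_false]
    split_ifs <;> push_cast <;> linarith

theorem windowSum_prominence_treeWord (t : BinaryTree Unit) {s a z : ℕ} (ha : a < s)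
    (hz : z < s) :
    windowSum prominence a (treeWord s t) z =
      tollSum (fun p q => (if p = 1 then 1 else 0) * q +
          (if p = 0 then 1 else 0) * (if q = 0 then 1 else 0)) t +
        (if t.numNodes = 1 then s - 1 - max a z else 0 : ℤ) := by
  induction t generalizing s a z with
  | nil => rfl
  | node _ L R ihL ihR =>
    obtain ⟨x, y, h, hx, hy⟩ := exists_windowSum_treeWord_node prominence s a z L R
    have hroot : prominence x s y =
        if L.numNodes = 0 ∧ R.numNodes = 0 then (s : ℤ) - max a z else 0 := by
      rw [prominence]
      split_ifs at hx hy ⊢ <;> omega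
    rw [h, ihL (by omega) (by omega), ihR (by omega) (by omega), max_eq_right ha.le,
      max_eq_left hz.le, hroot, tollSum]
    simp only [numNodes]
    split_ifs <;> omega

end Tolls

section GeneratingFunctions

/-- The generating function `∑ t, F t * X ^ t.numNodes` of a statistic `F` on binary trees. -/
def treeSeries (F : BinaryTree Unit → ℤ) : PowerSeries ℤ :=
  .mk fun n => ∑ t ∈ treesOfNumNodesEq n, F t

/-- The generating function of the total contribution of the tolls `e p q` of the roots. -/
def tollSeries (e : ℕ → ℕ → ℤ) : PowerSeries ℤ :=
  .mk fun n => ∑ ij ∈ antidiagonal n, catalan ij.1 * catalan ij.2 * e ij.1 ij.2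

/-- The generating function of the Catalan numbers, with the `n`-th one weighted by `φ n`. -/
def weightedCatalanSeries (φ : ℕ → ℤ) : PowerSeries ℤ :=
  .mk fun n => catalan n * φ n

/-- The Catalan generating function, with integer coefficients. -/
noncomputable def intCatalanSeries : PowerSeries ℤ :=
  PowerSeries.catalanSeries.map (Nat.castRingHom ℤ)

/-- The generating function of the central binomial coefficients. -/
def centralBinomSeries : PowerSeries ℤ :=
  .mk fun n => n.centralBinom

@[simp]
theorem coeff_intCatalanSeries (n : ℕ) : coeff n intCatalanSeries = catalan n := by
  simp [intCatalanSeries]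

@[simp]
theorem coeff_centralBinomSeries (n : ℕ) : coeff n centralBinomSeries = n.centralBinom :=
  PowerSeries.coeff_mk _ _

theorem intCatalanSeries_eq : intCatalanSeries = 1 + X * intCatalanSeries ^ 2 := by
  have h := congrArg (PowerSeries.map (Nat.castRingHom ℤ))
    PowerSeries.catalanSeries_sq_mul_X_add_one
  simp only [map_add, map_mul, map_pow, map_one, PowerSeries.map_X] at h
  rw [intCatalanSeries]
  linear_combination -h

theorem derivative_X_mul_intCatalanSeries :
    PowerSeries.derivative ℤ (X * intCatalanSeries) = centralBinomSeries := by
  ext n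
  rw [PowerSeries.coeff_derivative, PowerSeries.coeff_succ_X_mul, coeff_intCatalanSeries,
    coeff_centralBinomSeries, mul_comm]
  exact_mod_cast succ_mul_catalan_eq_centralBinom n

theorem centralBinomSeries_eq :
    centralBinomSeries = 1 + 2 * X * intCatalanSeries * centralBinomSeries := by
  have hX : X * intCatalanSeries = X + (X * intCatalanSeries) ^ 2 := by
    linear_combination X * intCatalanSeries_eq
  have h := congrArg (PowerSeries.derivative ℤ) hX
  rw [map_add, Derivation.leibniz_pow, derivative_X_mul_intCatalanSeries,
    PowerSeries.derivative_X] at h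
  simp only [smul_eq_mul, nsmul_eq_mul] at h
  push_cast at h
  linear_combination h

theorem intCatalanSeries_mul_centralBinomSeries :
    intCatalanSeries * centralBinomSeries = 2 * centralBinomSeries - intCatalanSeries := by
  linear_combination 2 * centralBinomSeries * intCatalanSeries_eq -
    intCatalanSeries * centralBinomSeries_eq

theorem centralBinomSeries_sq_eq :
    centralBinomSeries ^ 2 = 1 + X * (4 • centralBinomSeries ^ 2) := by
  linear_combination
    (centralBinomSeries - 2 * X * intCatalanSeries * centralBinomSeries + 1) *
      centralBinomSeries_eq + 4 * X * centralBinomSeries ^ 2 * intCatalanSeries_eq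

theorem coeff_centralBinomSeries_sq (n : ℕ) : coeff n (centralBinomSeries ^ 2) = 4 ^ n := by
  induction n with
  | zero => simp [centralBinomSeries]
  | succ n ih =>
    rw [centralBinomSeries_sq_eq, map_add, PowerSeries.coeff_succ_X_mul, PowerSeries.coeff_one,
      if_neg n.succ_ne_zero, zero_add, map_nsmul, ih, pow_succ', nsmul_eq_mul, Nat.cast_ofNat]

theorem sum_treesOfNumNodesEq_succ {M : Type*} [AddCommMonoid M] (F : BinaryTree Unit → M)
    (n : ℕ) :
    ∑ t ∈ treesOfNumNodesEq (n + 1), F t = ∑ ij ∈ antidiagonal n,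
      ∑ L ∈ treesOfNumNodesEq ij.1, ∑ R ∈ treesOfNumNodesEq ij.2, F (.node () L R) := by
  rw [treesOfNumNodesEq_succ, sum_biUnion]
  · refine sum_congr rfl fun ij _ => ?_
    rw [pairwiseNode, sum_map, sum_product]
    rfl
  · simp_rw [Set.PairwiseDisjoint, Set.Pairwise, disjoint_left]
    aesop

theorem treeSeries_tollSum_eq (e : ℕ → ℕ → ℤ) :
    treeSeries (tollSum e) = X * (treeSeries (tollSum e) * intCatalanSeries +
      intCatalanSeries * treeSeries (tollSum e) + tollSeries e) := by
  ext n
  rcases n with _ | n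
  · simp [treeSeries, tollSum]
  have hroot (i j : ℕ) : ∑ L ∈ treesOfNumNodesEq i, ∑ R ∈ treesOfNumNodesEq j,
      tollSum e (.node () L R) =
        (∑ L ∈ treesOfNumNodesEq i, tollSum e L) * catalan j +
          catalan i * (∑ R ∈ treesOfNumNodesEq j, tollSum e R) + catalan i * catalan j * e i j := by
    have htoll : ∀ L ∈ treesOfNumNodesEq i, ∀ R ∈ treesOfNumNodesEq j,
        tollSum e (.node () L R) = tollSum e L + tollSum e R + e i j := fun L hL R hR => by
      rw [tollSum, mem_treesOfNumNodesEq.1 hL, mem_treesOfNumNodesEq.1 hR]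
    rw [sum_congr rfl fun L hL => sum_congr rfl (htoll L hL)]
    simp only [sum_add_distrib, sum_const, treesOfNumNodesEq_card_eq_catalan, nsmul_eq_mul,
      mul_sum, sum_mul]
    simp only [mul_comm, mul_left_comm]
  rw [PowerSeries.coeff_succ_X_mul]
  simp only [treeSeries, tollSeries, map_add, PowerSeries.coeff_mul, PowerSeries.coeff_mk,
    coeff_intCatalanSeries, sum_treesOfNumNodesEq_succ, hroot, sum_add_distrib]

theorem treeSeries_tollSum (e : ℕ → ℕ → ℤ) :
    treeSeries (tollSum e) = X * centralBinomSeries * tollSeries e := by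
  linear_combination centralBinomSeries * treeSeries_tollSum_eq e -
    treeSeries (tollSum e) * centralBinomSeries_eq

theorem coeff_treeSeries (F : BinaryTree Unit → ℤ) (n : ℕ) :
    coeff n (treeSeries F) = ∑ t ∈ treesOfNumNodesEq n, F t :=
  PowerSeries.coeff_mk _ _

theorem tollSeries_add (e e' : ℕ → ℕ → ℤ) :
    tollSeries (fun p q => e p q + e' p q) = tollSeries e + tollSeries e' := by
  ext n
  simp only [tollSeries, PowerSeries.coeff_mk, map_add, ← sum_add_distrib, mul_add]

theorem tollSeries_mul (φ ψ : ℕ → ℤ) :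
    tollSeries (fun p q => φ p * ψ q) = weightedCatalanSeries φ * weightedCatalanSeries ψ := by
  ext n
  simp only [tollSeries, weightedCatalanSeries, PowerSeries.coeff_mk, PowerSeries.coeff_mul]
  exact sum_congr rfl fun _ _ => by ring

theorem coeff_weightedCatalanSeries (φ : ℕ → ℤ) (n : ℕ) :
    coeff n (weightedCatalanSeries φ) = catalan n * φ n :=
  PowerSeries.coeff_mk _ _

theorem weightedCatalanSeries_const (k : ℤ) :
    weightedCatalanSeries (fun _ => k) = k * intCatalanSeries := by
  ext n
  rw [coeff_weightedCatalanSeries, ← zsmul_eq_mul, map_zsmul, coeff_intCatalanSeries, smul_eq_mul,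
    mul_comm]

theorem weightedCatalanSeries_indicator_zero :
    weightedCatalanSeries (fun n => if n = 0 then 1 else 0) = 1 := by
  ext n
  rw [coeff_weightedCatalanSeries, PowerSeries.coeff_one]
  split_ifs with h <;> simp [h]

theorem weightedCatalanSeries_indicator_one :
    weightedCatalanSeries (fun n => if n = 1 then 1 else 0) = X := by
  ext n
  rw [coeff_weightedCatalanSeries, PowerSeries.coeff_X]
  split_ifs with h <;> simp [h]

theorem weightedCatalanSeries_zero_else_const (k : ℤ) :
    weightedCatalanSeries (fun n => if n = 0 then 0 else k) = k * (intCatalanSeries - 1) := by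
  ext n
  rw [coeff_weightedCatalanSeries, ← zsmul_eq_mul, map_zsmul, map_sub, coeff_intCatalanSeries,
    PowerSeries.coeff_one]
  split_ifs with h <;> simp [h, mul_comm]

theorem weightedCatalanSeries_natCast :
    weightedCatalanSeries (fun n => n) = centralBinomSeries - intCatalanSeries := by
  ext n
  have h : ((n + 1) * catalan n : ℤ) = n.centralBinom :=
    mod_cast succ_mul_catalan_eq_centralBinom n
  rw [coeff_weightedCatalanSeries, map_sub, coeff_centralBinomSeries, coeff_intCatalanSeries]
  linear_combination h

theorem treeSeries_peak :
    treeSeries (fun t => windowSum peak 0 (treeWord 1 t) 0) = X * centralBinomSeries := by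
  simp only [windowSum_peak_treeWord _ one_pos one_pos, treeSeries_tollSum, tollSeries_mul,
    weightedCatalanSeries_indicator_zero, mul_one]

theorem treeSeries_exposure :
    treeSeries (fun t => windowSum exposure 0 (treeWord 1 t) 0) =
      X * (2 * centralBinomSeries ^ 2) := by
  have h : tollSeries (fun p q => 2 * 1 + (if p = 0 then 0 else 2) * q) =
      2 * centralBinomSeries := by
    simp only [tollSeries_add fun _ _ => 2 * 1, tollSeries_mul, weightedCatalanSeries_const,
      weightedCatalanSeries_zero_else_const, weightedCatalanSeries_natCast]
    push_cast
    linear_combination 2 * intCatalanSeries_mul_centralBinomSeries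
  have hsum : (fun t => windowSum exposure 0 (treeWord 1 t) 0) =
      tollSum (fun p q => 2 * 1 + (if p = 0 then 0 else 2) * q) :=
    funext fun t => by simp [windowSum_exposure_treeWord t one_pos one_pos]
  rw [hsum, treeSeries_tollSum, h]
  ring

theorem two_mul_treeSeries_prominence :
    2 * treeSeries (fun t => windowSum prominence 0 (treeWord 1 t) 0) =
      X * (X * (2 * centralBinomSeries ^ 2) + (centralBinomSeries + 1)) := by
  have h : tollSeries (fun p q => (if p = 1 then 1 else 0) * q +
      (if p = 0 then 1 else 0) * (if q = 0 then 1 else 0)) =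
        X * (centralBinomSeries - intCatalanSeries) + 1 := by
    simp only [tollSeries_add fun p q => (if p = 1 then 1 else 0) * q, tollSeries_mul,
      weightedCatalanSeries_indicator_one, weightedCatalanSeries_natCast,
      weightedCatalanSeries_indicator_zero, mul_one]
  have hsum : (fun t => windowSum prominence 0 (treeWord 1 t) 0) =
      tollSum (fun p q => (if p = 1 then 1 else 0) * q +
        (if p = 0 then 1 else 0) * (if q = 0 then 1 else 0)) :=
    funext fun t => by simp [windowSum_prominence_treeWord t one_pos one_pos]
  rw [hsum, treeSeries_tollSum, h]
  linear_combination X * centralBinomSeries_eq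

end GeneratingFunctions

section Totals

/-- The sum of `f a b c` over all columns of the grid graphs of the `213`-avoiding permutations of
size `n`, where `b` is the height of the column and `a`, `c` are those of its neighbours. -/
def columnTotal (f : ℕ → ℕ → ℕ → ℤ) (n : ℕ) : ℤ :=
  ∑ π ∈ av213 n, windowSum f 0 (columnHeights π) 0

theorem columnTotal_eq_coeff (f : ℕ → ℕ → ℕ → ℤ) (n : ℕ) :
    columnTotal f n = coeff n (treeSeries fun t => windowSum f 0 (treeWord 1 t) 0) := by
  rw [coeff_treeSeries, ← sum_av213_eq_sum_trees fun l => windowSum f 0 l 0, columnTotal]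

theorem columnTotal_peak (n : ℕ) : columnTotal peak (n + 1) = n.centralBinom := by
  rw [columnTotal_eq_coeff, treeSeries_peak, PowerSeries.coeff_succ_X_mul,
    coeff_centralBinomSeries]

theorem columnTotal_exposure (n : ℕ) : columnTotal exposure (n + 1) = 2 * 4 ^ n := by
  rw [columnTotal_eq_coeff, treeSeries_exposure, PowerSeries.coeff_succ_X_mul,
    show (2 : PowerSeries ℤ) = PowerSeries.C 2 from rfl, PowerSeries.coeff_C_mul,
    coeff_centralBinomSeries_sq]

theorem two_mul_columnTotal_prominence (n : ℕ) :
    2 * columnTotal prominence (n + 2) = 2 * 4 ^ n + (n + 1).centralBinom := by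
  have h := congrArg (coeff (n + 2)) two_mul_treeSeries_prominence
  rw [show (2 : PowerSeries ℤ) = PowerSeries.C 2 from rfl, PowerSeries.coeff_C_mul,
    ← columnTotal_eq_coeff, PowerSeries.coeff_succ_X_mul, map_add, PowerSeries.coeff_succ_X_mul,
    PowerSeries.coeff_C_mul, coeff_centralBinomSeries_sq, map_add, coeff_centralBinomSeries,
    PowerSeries.coeff_one, if_neg n.succ_ne_zero, add_zero] at h
  exact h

theorem columnTotal_sub (f g : ℕ → ℕ → ℕ → ℤ) (n : ℕ) :
    columnTotal (fun a b c => f a b c - g a b c) n = columnTotal f n - columnTotal g n := by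
  simp only [columnTotal, windowSum_eq_sum_range, sum_sub_distrib]

theorem columnTotal_const_mul (k : ℤ) (f : ℕ → ℕ → ℕ → ℤ) (n : ℕ) :
    columnTotal (fun a b c => k * f a b c) n = k * columnTotal f n := by
  simp only [columnTotal, windowSum_eq_sum_range, mul_sum]

theorem columnTotal_const (k : ℤ) (n : ℕ) :
    columnTotal (fun _ _ _ => k) n = k * (n * catalan n) := by
  simp only [columnTotal, windowSum_const, length_columnHeights, sum_const, card_av213,
    nsmul_eq_mul]
  ring

theorem abs_columnTotal_sub_le {f g h : ℕ → ℕ → ℕ → ℤ}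
    (hfg : ∀ a b c, |f a b c - g a b c| ≤ h a b c) (n : ℕ) :
    |columnTotal f n - columnTotal g n| ≤ columnTotal h n := by
  rw [columnTotal, columnTotal, ← sum_sub_distrib]
  exact (abs_sum_le_sum_abs _ _).trans (sum_le_sum fun π _ => abs_windowSum_sub_le hfg 0 0 _)

theorem columnTotal_zero_neighbours_le (n : ℕ) :
    columnTotal (fun a _ c => (if a = 0 then 1 else 0) + (if c = 0 then 1 else 0)) n ≤
      2 * catalan n := by
  rw [columnTotal, ← card_av213, mul_comm, ← nsmul_eq_mul]
  refine sum_le_card_nsmul _ _ _ fun π _ => windowSum_zero_neighbours_le 0 fun x hx => ?_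
  have := List.mem_range'_1.1 ((columnHeights_perm_range' π).mem_iff.1 hx)
  omega

theorem degreeTotal_eq_columnTotal (r n : ℕ) :
    (degreeTotal r n : ℤ) = columnTotal (fun a b c => columnCount r a b c) n := by
  simp only [degreeTotal, columnTotal, card_degree_eq_windowSum, windowSum_eq_sum_range,
    Nat.cast_sum]

theorem card_gridVertex {n : ℕ} (π : Equiv.Perm (Fin n)) :
    Fintype.card (GridVertex π) = windowSum (fun _ b _ => b) 0 (columnHeights π) 0 := by
  rw [Fintype.card_eq_sum_ones, sum_gridVertex π fun _ _ => 1, windowSum_columnHeights]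
  simp only [sum_const, card_range, smul_eq_mul, mul_one]

theorem windowSum_middle {M : Type*} [AddCommMonoid M] (a z : M) (l : List M) :
    windowSum (fun _ b _ => b) a l z = l.sum := by
  induction l generalizing a with
  | nil => rfl
  | cons b l ih => rw [windowSum, ih, List.sum_cons]

theorem vertexTotal_eq_columnTotal (n : ℕ) :
    (vertexTotal n : ℤ) = columnTotal (fun _ b _ => b) n := by
  simp only [vertexTotal, columnTotal, card_gridVertex, windowSum_eq_sum_range, Nat.cast_sum]

theorem sum_range'_one_mul_two (n : ℕ) : (List.range' 1 n).sum * 2 = n * (n + 1) := by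
  induction n with
  | zero => rfl
  | succ n ih =>
    rw [List.range'_1_concat, List.sum_append, List.sum_singleton, add_mul, ih]
    ring

theorem two_mul_vertexTotal (n : ℕ) : 2 * vertexTotal n = n * n.centralBinom := by
  have hsum (π : Equiv.Perm (Fin n)) : Fintype.card (GridVertex π) = (List.range' 1 n).sum := by
    rw [card_gridVertex, windowSum_middle, (columnHeights_perm_range' π).sum_eq]
  rw [vertexTotal, sum_congr rfl fun π _ => hsum π, sum_const, card_av213, smul_eq_mul,
    ← succ_mul_catalan_eq_centralBinom]
  linear_combination catalan n * sum_range'_one_mul_two n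

theorem abs_degreeTotal_one_sub_columnTotal_le (n : ℕ) :
    |(degreeTotal 1 n : ℤ) - columnTotal peak n| ≤ 2 * catalan n := by
  rw [degreeTotal_eq_columnTotal]
  exact (abs_columnTotal_sub_le abs_columnCount_one_sub_peak_le n).trans
    (columnTotal_zero_neighbours_le n)

theorem abs_degreeTotal_two_sub_columnTotal_le (n : ℕ) :
    |(degreeTotal 2 n : ℤ) - columnTotal prominence n| ≤ 2 * (n * catalan n) := by
  rw [degreeTotal_eq_columnTotal]
  simpa only [sideCount_zero, columnTotal_const] using
    abs_columnTotal_sub_le (abs_columnCount_sub_sideCount_le 0) n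

theorem abs_degreeTotal_three_sub_columnTotal_le (n : ℕ) :
    |(degreeTotal 3 n : ℤ) - (columnTotal exposure n - 2 * columnTotal prominence n)| ≤
      2 * (n * catalan n) := by
  rw [degreeTotal_eq_columnTotal, ← columnTotal_const_mul, ← columnTotal_sub]
  simpa only [sideCount_one, columnTotal_const] using
    abs_columnTotal_sub_le (abs_columnCount_sub_sideCount_le 1) n

theorem abs_degreeTotal_four_sub_columnTotal_le (n : ℕ) :
    |(degreeTotal 4 n : ℤ) -
      (vertexTotal n - (columnTotal exposure n - columnTotal prominence n))| ≤
        2 * (n * catalan n) := by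
  rw [degreeTotal_eq_columnTotal, vertexTotal_eq_columnTotal, ← columnTotal_sub, ← columnTotal_sub]
  simpa only [sideCount_two, columnTotal_const] using
    abs_columnTotal_sub_le (abs_columnCount_sub_sideCount_le 2) n

end Totals

section Asymptotics

theorem gridV_eq (n : ℕ) : gridV n = n / 2 * n.centralBinom := by
  rw [gridV, Nat.centralBinom_eq_two_mul_choose]

theorem gridV_pos {n : ℕ} (hn : 0 < n) : 0 < gridV n := by
  have := n.centralBinom_pos
  rw [gridV_eq]
  positivity

theorem vertexTotal_eq_gridV (n : ℕ) : (vertexTotal n : ℝ) = gridV n := by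
  have h : (2 * vertexTotal n : ℝ) = n * n.centralBinom := mod_cast two_mul_vertexTotal n
  rw [gridV_eq]
  linear_combination h / 2

theorem mul_catalan_le_centralBinom (n : ℕ) : n * catalan n ≤ n.centralBinom := by
  rw [← succ_mul_catalan_eq_centralBinom]
  gcongr
  exact n.le_succ

theorem columnTotal_exposure_eq {n : ℕ} (hn : 1 ≤ n) :
    (columnTotal exposure n : ℝ) = 4 ^ n / 2 := by
  obtain ⟨m, rfl⟩ := Nat.exists_eq_add_of_le' hn
  rw [columnTotal_exposure]
  push_cast
  ring

theorem abs_columnTotal_prominence_sub_le {n : ℕ} (hn : 2 ≤ n) :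
    |(columnTotal prominence n : ℝ) - 4 ^ n / 16| ≤ n.centralBinom := by
  obtain ⟨m, rfl⟩ := Nat.exists_eq_add_of_le' hn
  have h : (2 * columnTotal prominence (m + 2) : ℝ) = 2 * 4 ^ m + (m + 1).centralBinom :=
    mod_cast two_mul_columnTotal_prominence m
  have hle : ((m + 1).centralBinom : ℝ) ≤ (m + 2).centralBinom :=
    mod_cast Nat.centralBinom_strictMono.monotone (m + 1).le_succ
  have heq : (columnTotal prominence (m + 2) : ℝ) - 4 ^ (m + 2) / 16 =
      (m + 1).centralBinom / 2 := by
    linear_combination h / 2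
  rw [heq, abs_of_nonneg (by positivity)]
  linarith [((m + 1).centralBinom.cast_nonneg : (0 : ℝ) ≤ _)]

theorem abs_degreeTotal_two_sub_four_pow_le {n : ℕ} (hn : 2 ≤ n) :
    |(degreeTotal 2 n : ℝ) - 1 / 16 * 4 ^ n| ≤ 4 * n.centralBinom := by
  have hP := abs_columnTotal_prominence_sub_le hn
  have hQ : |(degreeTotal 2 n : ℝ) - columnTotal prominence n| ≤ 2 * (n * catalan n) :=
    mod_cast abs_degreeTotal_two_sub_columnTotal_le n
  have hC : (n * catalan n : ℝ) ≤ n.centralBinom := mod_cast mul_catalan_le_centralBinom n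
  rw [abs_le] at *
  constructor <;> linarith

theorem abs_degreeTotal_three_sub_four_pow_le {n : ℕ} (hn : 2 ≤ n) :
    |(degreeTotal 3 n : ℝ) - 3 / 8 * 4 ^ n| ≤ 4 * n.centralBinom := by
  have hE := columnTotal_exposure_eq (one_le_two.trans hn)
  have hP := abs_columnTotal_prominence_sub_le hn
  have hQ : |(degreeTotal 3 n : ℝ) - (columnTotal exposure n - 2 * columnTotal prominence n)| ≤
      2 * (n * catalan n) := mod_cast abs_degreeTotal_three_sub_columnTotal_le n
  have hC : (n * catalan n : ℝ) ≤ n.centralBinom := mod_cast mul_catalan_le_centralBinom n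
  rw [abs_le] at *
  constructor <;> linarith

theorem abs_degreeTotal_four_sub_four_pow_le {n : ℕ} (hn : 2 ≤ n) :
    |(degreeTotal 4 n - gridV n) - -(7 / 16) * 4 ^ n| ≤ 4 * n.centralBinom := by
  have hE := columnTotal_exposure_eq (one_le_two.trans hn)
  have hP := abs_columnTotal_prominence_sub_le hn
  have hQ : |(degreeTotal 4 n : ℝ) -
      (vertexTotal n - (columnTotal exposure n - columnTotal prominence n))| ≤
        2 * (n * catalan n) := mod_cast abs_degreeTotal_four_sub_columnTotal_le n
  have hC : (n * catalan n : ℝ) ≤ n.centralBinom := mod_cast mul_catalan_le_centralBinom n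
  rw [vertexTotal_eq_gridV] at hQ
  rw [abs_le] at *
  constructor <;> linarith

theorem abs_degreeTotal_one_sub_centralBinom_le {n : ℕ} (hn : 1 ≤ n) :
    |(degreeTotal 1 n : ℝ) - n.centralBinom / 4| ≤ 3 * n.centralBinom / n := by
  obtain ⟨m, rfl⟩ := Nat.exists_eq_add_of_le' hn
  have hQ : |(degreeTotal 1 (m + 1) : ℝ) - m.centralBinom| ≤ 2 * catalan (m + 1) := by
    have h := abs_degreeTotal_one_sub_columnTotal_le (m + 1)
    rw [columnTotal_peak] at h
    exact_mod_cast h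
  have hC : ((m + 2) * catalan (m + 1) : ℝ) = (m + 1).centralBinom :=
    mod_cast succ_mul_catalan_eq_centralBinom (m + 1)
  have hB : ((m + 1) * (m + 1).centralBinom : ℝ) = 2 * (2 * m + 1) * m.centralBinom :=
    mod_cast Nat.succ_mul_centralBinom_succ m
  have hcross : (m + 1 : ℝ) * |(m.centralBinom : ℝ) - (m + 1).centralBinom / 4| =
      m.centralBinom / 2 := by
    rw [← abs_of_nonneg (by positivity : (0 : ℝ) ≤ m + 1), ← abs_mul,
      show (m + 1 : ℝ) * (m.centralBinom - (m + 1).centralBinom / 4) = m.centralBinom / 2 by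
        linear_combination -hB / 4, abs_of_nonneg (by positivity)]
  have hle : (m.centralBinom : ℝ) ≤ (m + 1).centralBinom :=
    mod_cast Nat.centralBinom_strictMono.monotone m.le_succ
  push_cast
  rw [le_div_iff₀ (by positivity)]
  calc |(degreeTotal 1 (m + 1) : ℝ) - (m + 1).centralBinom / 4| * (m + 1)
    _ ≤ (2 * catalan (m + 1) + |(m.centralBinom : ℝ) - (m + 1).centralBinom / 4|) * (m + 1) := by
      gcongr
      exact (abs_sub_le _ _ _).trans (by gcongr)
    _ ≤ 3 * (m + 1).centralBinom := by
      have := (catalan (m + 1)).cast_nonneg (α := ℝ)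
      linarith

theorem wallis_mul_centralBinom_sq (n : ℕ) :
    Real.Wallis.W n * (2 * n + 1) * (n.centralBinom : ℝ) ^ 2 = (4 ^ n) ^ 2 := by
  induction n with
  | zero => simp [Real.Wallis.W]
  | succ n ih =>
    have h : ((n : ℝ) + 1) * (n + 1).centralBinom = 2 * (2 * n + 1) * n.centralBinom :=
      mod_cast Nat.succ_mul_centralBinom_succ n
    have h' : ((n + 1).centralBinom : ℝ) = 2 * (2 * n + 1) * n.centralBinom / (n + 1) := by
      rw [eq_div_iff (by positivity), ← h, mul_comm]
    rw [Real.Wallis.W_succ, h', pow_succ (4 : ℝ), mul_pow, ← ih]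
    push_cast
    field_simp
    ring

theorem four_pow_div_centralBinom_sq (n : ℕ) :
    ((4 : ℝ) ^ n / n.centralBinom) ^ 2 = Real.Wallis.W n * (2 * n + 1) := by
  have hB : (n.centralBinom : ℝ) ≠ 0 := mod_cast n.centralBinom_ne_zero
  rw [div_pow, ← wallis_mul_centralBinom_sq, mul_div_cancel_right₀ _ (pow_ne_zero 2 hB)]

theorem sqrt_pi_mul_le_four_pow_div_centralBinom (n : ℕ) :
    √(Real.pi * n) ≤ 4 ^ n / n.centralBinom := by
  refine Real.sqrt_le_iff.2 ⟨by positivity, ?_⟩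
  have hpi := Real.pi_pos
  calc Real.pi * n ≤ (2 * n + 1) / (2 * n + 2) * (Real.pi / 2) * (2 * n + 1) := by
        rw [div_mul_eq_mul_div, div_mul_eq_mul_div, le_div_iff₀ (by positivity)]
        nlinarith
    _ ≤ Real.Wallis.W n * (2 * n + 1) := by
        gcongr
        exact Real.Wallis.le_W n
    _ = (4 ^ n / n.centralBinom) ^ 2 := (four_pow_div_centralBinom_sq n).symm

theorem four_pow_div_centralBinom_le (n : ℕ) :
    (4 : ℝ) ^ n / n.centralBinom ≤ √(Real.pi * n) + 2 := by
  refine le_of_sq_le_sq ?_ (by positivity)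
  have hsq := Real.sq_sqrt (by positivity : 0 ≤ Real.pi * n)
  calc ((4 : ℝ) ^ n / n.centralBinom) ^ 2 = Real.Wallis.W n * (2 * n + 1) :=
        four_pow_div_centralBinom_sq n
    _ ≤ Real.pi / 2 * (2 * n + 1) := by
        gcongr
        exact Real.Wallis.W_le n
    _ ≤ (√(Real.pi * n) + 2) ^ 2 := by
        nlinarith [Real.pi_le_four, Real.sqrt_nonneg (Real.pi * n)]

theorem abs_four_pow_div_centralBinom_sub_le (n : ℕ) :
    |(4 : ℝ) ^ n / n.centralBinom - √(Real.pi * n)| ≤ 2 := by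
  rw [abs_of_nonneg (sub_nonneg.2 (sqrt_pi_mul_le_four_pow_div_centralBinom n))]
  linarith [four_pow_div_centralBinom_le n]

theorem sqrt_pi_mul_div {x : ℝ} (hx : 0 < x) :
    √(Real.pi * x) / x = √Real.pi * x ^ (-(1 / 2) : ℝ) := by
  rw [Real.sqrt_mul Real.pi_pos.le, mul_div_assoc, Real.sqrt_eq_rpow x, div_eq_mul_inv,
    ← Real.rpow_neg_one, ← Real.rpow_add hx]
  norm_num

theorem isBigO_div_gridV {f : ℕ → ℝ} {α K : ℝ}
    (hf : ∀ n : ℕ, 2 ≤ n → |f n - α * 4 ^ n| ≤ K * n.centralBinom) :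
    (fun n : ℕ => f n / gridV n - 2 * α * √Real.pi * (n : ℝ) ^ (-(1 / 2) : ℝ))
      =O[Filter.atTop] (fun n : ℕ => 1 / (n : ℝ)) := by
  refine IsBigO.of_bound (2 * (K + |α| * 2)) ?_
  filter_upwards [Filter.eventually_ge_atTop 2] with n hn
  have hpos : (0 : ℝ) < n := by exact_mod_cast (by omega : 0 < n)
  have hB : (0 : ℝ) < n.centralBinom := mod_cast n.centralBinom_pos
  have hsplit : f n / gridV n - 2 * α * √Real.pi * (n : ℝ) ^ (-(1 / 2) : ℝ) =
      2 * ((f n - α * 4 ^ n) / n.centralBinom +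
        α * (4 ^ n / n.centralBinom - √(Real.pi * n))) * (1 / n) := by
    rw [mul_assoc, ← sqrt_pi_mul_div hpos, gridV_eq]
    field_simp
    ring
  have hf' : |(f n - α * 4 ^ n) / n.centralBinom| ≤ K := by
    rw [abs_div, Nat.abs_cast, div_le_iff₀ hB]
    exact hf n hn
  rw [hsplit, norm_mul, Real.norm_eq_abs, abs_mul, abs_two]
  gcongr
  refine (abs_add_le _ _).trans (add_le_add hf' ?_)
  rw [abs_mul]
  gcongr
  exact abs_four_pow_div_centralBinom_sub_le n

theorem isBigO_degreeTotal_one :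
    (fun n : ℕ => (degreeTotal 1 n : ℝ) / gridV n - 1 / (2 * (n : ℝ)))
      =O[Filter.atTop] (fun n : ℕ => 1 / (n : ℝ) ^ 2) := by
  refine IsBigO.of_bound 6 ?_
  filter_upwards [Filter.eventually_ge_atTop 1] with n hn
  have hB : (0 : ℝ) < n.centralBinom := mod_cast n.centralBinom_pos
  have hsplit : (degreeTotal 1 n : ℝ) / gridV n - 1 / (2 * (n : ℝ)) =
      ((degreeTotal 1 n : ℝ) - n.centralBinom / 4) / gridV n := by
    rw [gridV_eq]
    field_simp
    ring
  rw [hsplit, Real.norm_eq_abs, abs_div, abs_of_pos (gridV_pos hn),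
    div_le_iff₀ (gridV_pos hn), Real.norm_of_nonneg (by positivity), gridV_eq]
  refine (abs_degreeTotal_one_sub_centralBinom_le hn).trans_eq ?_
  field_simp
  norm_num

theorem isBigO_degreeTotal_four :
    (fun n : ℕ => (degreeTotal 4 n : ℝ) / gridV n
        - (1 - 7 * Real.sqrt Real.pi / 8 * (n : ℝ) ^ (-(1 / 2) : ℝ)))
      =O[Filter.atTop] (fun n : ℕ => 1 / (n : ℝ)) := by
  refine (isBigO_div_gridV fun _ => abs_degreeTotal_four_sub_four_pow_le).congr' ?_ .rfl
  filter_upwards [Filter.eventually_gt_atTop 0] with n hn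
  rw [sub_div, div_self (gridV_pos hn).ne']
  ring

end Asymptotics

theorem mainTheorem5 :
    (∀ n : ℕ, (vertexTotal n : ℝ) = gridV n) ∧
    (fun n : ℕ => (degreeTotal 1 n : ℝ) / gridV n - 1 / (2 * (n : ℝ)))
      =O[Filter.atTop] (fun n : ℕ => 1 / (n : ℝ) ^ 2) ∧
    (fun n : ℕ => (degreeTotal 2 n : ℝ) / gridV n
        - Real.sqrt Real.pi / 8 * (n : ℝ) ^ (-(1 / 2) : ℝ))
      =O[Filter.atTop] (fun n : ℕ => 1 / (n : ℝ)) ∧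
    (fun n : ℕ => (degreeTotal 3 n : ℝ) / gridV n
        - 3 * Real.sqrt Real.pi / 4 * (n : ℝ) ^ (-(1 / 2) : ℝ))
      =O[Filter.atTop] (fun n : ℕ => 1 / (n : ℝ)) ∧
    (fun n : ℕ => (degreeTotal 4 n : ℝ) / gridV n
        - (1 - 7 * Real.sqrt Real.pi / 8 * (n : ℝ) ^ (-(1 / 2) : ℝ)))
      =O[Filter.atTop] (fun n : ℕ => 1 / (n : ℝ)) ∧
    Filter.Tendsto (fun n : ℕ => (degreeTotal 4 n : ℝ) / gridV n) Filter.atTop (nhds 1) := by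
  refine ⟨vertexTotal_eq_gridV, isBigO_degreeTotal_one, ?_, ?_, isBigO_degreeTotal_four, ?_⟩
  · refine (isBigO_div_gridV fun _ => abs_degreeTotal_two_sub_four_pow_le).congr_left fun n => ?_
    ring
  · refine (isBigO_div_gridV fun _ => abs_degreeTotal_three_sub_four_pow_le).congr_left fun n => ?_
    ring
  · have herror := isBigO_degreeTotal_four.trans_tendsto tendsto_one_div_atTop_nhds_zero_nat
    have hrpow : Filter.Tendsto (fun n : ℕ => (n : ℝ) ^ (-(1 / 2) : ℝ)) Filter.atTop (nhds 0) :=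
      (tendsto_rpow_neg_atTop (by norm_num)).comp tendsto_natCast_atTop_atTop
    simpa using herror.add ((hrpow.const_mul (7 * Real.sqrt Real.pi / 8)).const_sub 1)
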